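/- Let $K$ be a field, let $r\ge 2$, and let $a_1<a_2<\dots<a_r$ be an arithmetic sequence of positive integers with common difference $d>0$, which is a minimal system of generators of the semigroup $H=\langle a_1,\dots,a_r\rangle\subseteq\mathbb N$ (the $a_i$ need not be coprime). Let $S=K[x_1,\dots,x_r]$ and let $I_H\subset S$ be the kernel of the $K$-algebra homomorphism $S\to K[t]$, $x_i\mapsto t^{a_i}$. For $0\ne f\in S$ let $f^*$ be the nonzero homogeneous component of $f$ of least degree (in the standard grading), and for an ideal $I\subseteq S$ let $I^*=(f^*\mid 0\neq f\in I)$; a finite set of nonzero elements $f_1,\dots,f_m\in I$ is a standard basis of $I$ if $I^*=(f_1^*,\dots,f_m^*)$. For an ideal $I$ of $S$ let $\beta_i(I)=\dim_K\operatorname{Tor}_i^S(I,K)$, where $K=S/(x_1,\dots,x_r)$. Put $g=\gcd(a_1,d)$ and $e=d/g$. Then $a_1/g=a(r-1)+b$ for (unique) integers $a\ge1$ and $1\le b\le r-1$, and the polynomials $$\xi_{ij}=x_ix_{j+1}-x_{i+1}x_j\quad(1\le i<j\le r-1),\qquad \Delta_i=x_r^{a}x_{b+i}-x_1^{a+e}x_i\quad(1\le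 i\le r-b)$$ generate $I_H$, no proper subset of them generates $I_H$, and they form a standard basis of $I_H$. Moreover, $\beta_i(I_H^*)=\beta_i(I_H)$ for all $i\ge0$. -/

import Mathlib

open CategoryTheory

universe u

noncomputable section

namespace TangentCone

/-- The numbers `a i` form a minimal system of generators of the submonoid `H` of `ℕ`. -/
def MinimallyGenerates {r : ℕ} (a : Fin r → ℕ) (H : AddSubmonoid ℕ) : Prop :=
  AddSubmonoid.closure (Set.range a) = H ∧
    ∀ i, a i ∉ AddSubmonoid.closure (a '' {j | j ≠ i})

/-- Consecutive terms of the sequence differ by `d`. -/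
def IsArithmeticWithDifference {r : ℕ} (a : Fin r → ℕ) (d : ℕ) : Prop :=
  ∀ i j : Fin r, (j : ℕ) = i + 1 → a j = a i + d

/-- The kernel of the `K`-algebra map `K[x_1, …, x_r] → K[t]`, `x_i ↦ t ^ a_i`. -/
def semigroupIdeal (K : Type u) [Field K] {r : ℕ} (a : Fin r → ℕ) :
    Ideal (MvPolynomial (Fin r) K) :=
  RingHom.ker
    (MvPolynomial.aeval (R := K) fun i => (Polynomial.X : Polynomial K) ^ a i)

section InitialForms

variable {K : Type u} [Field K] {r : ℕ}

/-- The least degree of a nonzero homogeneous component of `f` (for `f ≠ 0`). -/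
def initialDegree (f : MvPolynomial (Fin r) K) : ℕ :=
  sInf {m | MvPolynomial.homogeneousComponent m f ≠ 0}

/-- The nonzero homogeneous component of least degree of `f` (for `f ≠ 0`). -/
def initialForm (f : MvPolynomial (Fin r) K) : MvPolynomial (Fin r) K :=
  MvPolynomial.homogeneousComponent (initialDegree f) f

/-- The ideal generated by the initial forms of the nonzero elements of `I`. -/
def initialIdeal (I : Ideal (MvPolynomial (Fin r) K)) : Ideal (MvPolynomial (Fin r) K) :=
  Ideal.span {g | ∃ f ∈ I, f ≠ 0 ∧ g = initialForm f}

/-- `G` is a finite set of nonzero elements of `I` whose initial forms generate the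
initial ideal of `I`. -/
def IsStandardBasis (G : Set (MvPolynomial (Fin r) K))
    (I : Ideal (MvPolynomial (Fin r) K)) : Prop :=
  G.Finite ∧ (∀ f ∈ G, f ∈ I ∧ f ≠ 0) ∧ Ideal.span (initialForm '' G) = initialIdeal I

/-- `G` generates `I`, and no proper subset of `G` does. -/
def IsMinimalGeneratingSet (G : Set (MvPolynomial (Fin r) K))
    (I : Ideal (MvPolynomial (Fin r) K)) : Prop :=
  Ideal.span G = I ∧ ∀ T, T ⊂ G → Ideal.span T ≠ I

end InitialForms

section Generators

variable (K : Type u) [Field K] (n : ℕ)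

/-- The `2 × 2` minors of the matrix with rows `x_1, …, x_n` and `x_2, …, x_{n+1}`.
The variable `x_k` is `X` of the element `k - 1` of `Fin (n + 1)`. -/
def scrollMinors : Set (MvPolynomial (Fin (n + 1)) K) :=
  {f | ∃ i j : Fin n, i < j ∧
    f = MvPolynomial.X i.castSucc * MvPolynomial.X j.succ -
      MvPolynomial.X i.succ * MvPolynomial.X j.castSucc}

/-- The binomials `x_{n+1} ^ q * x_{b+i} - x_1 ^ (q + e) * x_i`, `1 ≤ i ≤ n + 1 - b`. -/
def extraMinors (q b e : ℕ) : Set (MvPolynomial (Fin (n + 1)) K) :=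
  {f | ∃ i k : Fin (n + 1), (k : ℕ) = b + i ∧
    f = MvPolynomial.X (Fin.last n) ^ q * MvPolynomial.X k -
      MvPolynomial.X 0 ^ (q + e) * MvPolynomial.X i}

/-- The generators described by Patil and by Gimenez, Sengupta and Srinivasan. -/
def arithmeticGenerators (q b e : ℕ) : Set (MvPolynomial (Fin (n + 1)) K) :=
  scrollMinors K n ∪ extraMinors K n q b e

end Generators

section Betti

variable {K : Type u} [Field K] {r : ℕ}

/-- The field `K` as the module `S / (x_1, …, x_r)` over `S = K[x_1, …, x_r]`. -/
def residueModule (K : Type u) [Field K] (r : ℕ) : ModuleCat.{u} (MvPolynomial (Fin r) K) :=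
  ModuleCat.of _ (MvPolynomial (Fin r) K ⧸
    Ideal.span (Set.range (MvPolynomial.X : Fin r → MvPolynomial (Fin r) K)))

/-- The `i`-th Betti number `dim_K Tor_i^S(I, K)` of the `S`-module `I`. -/
def bettiNumber (i : ℕ) (I : Ideal (MvPolynomial (Fin r) K)) : ℕ :=
  Module.finrank K (RestrictScalars K (MvPolynomial (Fin r) K)
    (((Tor (ModuleCat.{u} (MvPolynomial (Fin r) K)) i).obj (ModuleCat.of _ I)).obj
      (residueModule K r)))

end Betti

end TangentCone

end

/-! Index the variables from zero, write `n = r - 1`, and give a monomial the bidegree `(D, s)`,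
with `D` its degree and `s` the sum of its indices. Its weight is `g * (m * D + e * s)`, where `m =
a 0 / g = q * n + b` is coprime to `e`.

Generation: modulo the scroll minors a monomial depends only on `(D, s)`. By coprimality, equal
weights mean bidegrees `(D, s)` and `(D + k * e, s - k * m)`, and the extra binomials realise the
step `k = 1` (`ArithmeticData.mk_monomial_eq`).

Standard basis: let `T` (`scrollTruncation`) consist of the polynomials whose image under `x_i ↦ s *
t ^ i` is divisible by `t ^ m`. Initial forms of elements of `I_H` lie in `T`, because a monomial
with `s < m` has no partner of the same weight and larger degree. Conversely, `T` lies in the span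
of the initial forms of the generators, since modulo these every monomial of index sum at least `m`
vanishes. Hence `T` is the initial ideal.

Betti numbers: `x_0` is a non-zero-divisor modulo `I_H` and modulo `T`, and both ideals become equal
after adding `x_0`. The long exact sequence of `Tor`, on which `x_0` acts as zero, recovers the
Betti numbers of either ideal `I` from `(I + (x_0)) / (x_0)` (`bettiNumber_eq_of_sup_span_eq`).

Minimality: each generator is separated from all multiples of the others by a linear functional. -/

noncomputable section

namespace TangentCone

/-! ### Tor and multiplication by an element that kills one argument -/

section TorSequence

open MonoidalCategory

variable {R : Type u} [CommRing R]

/-- The complex `M ⊗ P`. -/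
abbrev tensorComplex (P : ChainComplex (ModuleCat.{u} R) ℕ) (M : ModuleCat.{u} R) :
    ChainComplex (ModuleCat.{u} R) ℕ :=
  (((tensoringLeft (ModuleCat.{u} R)).obj M).mapHomologicalComplex _).obj P

/-- The chain map `M ⊗ P ⟶ N ⊗ P` induced by `M ⟶ N`. -/
abbrev tensorComplexMap (P : ChainComplex (ModuleCat.{u} R) ℕ) {M N : ModuleCat.{u} R}
    (f : M ⟶ N) : tensorComplex P M ⟶ tensorComplex P N :=
  (NatTrans.mapHomologicalComplex ((tensoringLeft (ModuleCat.{u} R)).map f) _).app P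

/-- Tensoring a complex of modules with a short complex of modules. -/
def tensorShortComplex (P : ChainComplex (ModuleCat.{u} R) ℕ)
    (E : ShortComplex (ModuleCat.{u} R)) : ShortComplex (ChainComplex (ModuleCat.{u} R) ℕ) where
  X₁ := tensorComplex P E.X₁
  X₂ := tensorComplex P E.X₂
  X₃ := tensorComplex P E.X₃
  f := tensorComplexMap P E.f
  g := tensorComplexMap P E.g
  zero := by
    ext i : 1
    change E.f ▷ P.X i ≫ E.g ▷ P.X i = 0
    rw [← comp_whiskerRight, E.zero, MonoidalPreadditive.zero_whiskerRight]

theorem tensorShortComplex_shortExact (P : ChainComplex (ModuleCat.{u} R) ℕ)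
    [∀ i, Projective (P.X i)] {E : ShortComplex (ModuleCat.{u} R)} (hE : E.ShortExact) :
    (tensorShortComplex P E).ShortExact := by
  apply HomologicalComplex.shortExact_of_degreewise_shortExact
  intro i
  have : Module.Projective R (P.X i) := (IsProjective.iff_projective _).2 inferInstance
  have := hE.mono_f
  have := hE.epi_g
  exact hE.map (tensorRight (P.X i))

theorem isZero_homology_tensorComplex_of_flat {X : ModuleCat.{u} R} (P : ProjectiveResolution X)
    (M : ModuleCat.{u} R) [Module.Flat R M] (i : ℕ) :
    Limits.IsZero ((tensorComplex P.complex M).homology (i + 1)) := by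
  rw [← HomologicalComplex.exactAt_iff_isZero_homology]
  have h : ((P.complex.sc (i + 1)).map ((tensoringLeft (ModuleCat.{u} R)).obj M)).Exact :=
    Module.Flat.lTensor_shortComplex_exact M _ (P.complex_exactAt_succ i)
  exact h

theorem homologyMap_smul (A : ChainComplex (ModuleCat.{u} R) ℕ) (x : R) (i : ℕ) :
    HomologicalComplex.homologyMap (x • 𝟙 A) i = x • 𝟙 (A.homology i) := by
  rw [← HomologicalComplex.homologyMap_id A i]
  exact ShortComplex.homologyMap_smul
    ((HomologicalComplex.shortComplexFunctor _ _ i).map (𝟙 A)) x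

/-- Both `x • 𝟙` and `0` on the resolution lift the zero endomorphism of `X`, so they induce the
same map on homology. -/
theorem smul_homology_tensorComplex {X : ModuleCat.{u} R} (P : ProjectiveResolution X)
    (M : ModuleCat.{u} R) (i : ℕ) {x : R} (hx : ∀ z : X, x • z = 0)
    (z : (tensorComplex P.complex M).homology i) : x • z = 0 := by
  let F := (tensoringLeft (ModuleCat.{u} R)).obj M
  have h0 : (HomologicalComplex.homologyMap
      ((F.mapHomologicalComplex (ComplexShape.down ℕ)).map (x • 𝟙 P.complex)) i) = 0 := by
    have hlift : (x • 𝟙 P.complex : P.complex ⟶ P.complex).f 0 ≫ P.π.f 0 =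
        P.π.f 0 ≫ (0 : X ⟶ X) := by
      refine Eq.trans ?_ Limits.comp_zero.symm
      rw [HomologicalComplex.smul_f_apply, HomologicalComplex.id_f,
        Linear.smul_comp, Category.id_comp]
      ext z
      exact hx _
    have h := P.isoLeftDerivedObj_hom_naturality (0 : X ⟶ X) P (x • 𝟙 P.complex) hlift F i
    have h' := P.isoLeftDerivedObj_hom_naturality (0 : X ⟶ X) P 0
      (Limits.zero_comp.trans Limits.comp_zero.symm) F i
    rw [h', Functor.map_zero] at h
    exact ((cancel_epi (P.isoLeftDerivedObj F i).hom).1 h).symm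
  have h1 : (F.mapHomologicalComplex (ComplexShape.down ℕ)).map (x • 𝟙 P.complex) =
      x • 𝟙 (tensorComplex P.complex M) := by
    ext j : 1
    simp [F]
  rw [h1, homologyMap_smul] at h0
  exact congrArg (fun φ => φ.hom z) h0

theorem homologyMap_tensorComplexMap_smul {X : ModuleCat.{u} R} (P : ProjectiveResolution X)
    {M : ModuleCat.{u} R} (i : ℕ) {x : R} (hx : ∀ z : X, x • z = 0) :
    HomologicalComplex.homologyMap (tensorComplexMap P.complex (x • 𝟙 M)) i = 0 := by
  have h1 : tensorComplexMap P.complex (x • 𝟙 M) = x • 𝟙 (tensorComplex P.complex M) := by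
    ext j : 1
    simp
    rfl
  rw [h1, homologyMap_smul]
  ext z
  exact smul_homology_tensorComplex P M i hx z

/-- Dimension shifting in `M`: the connecting map of a free cover embeds degree `i + 1` into degree
`i` of the kernel. The terms of `P` thus need not be finitely generated. -/
theorem finite_homology_tensorComplex [IsNoetherianRing R] {X : ModuleCat.{u} R}
    [Module.Finite R X] (P : ProjectiveResolution X) (i : ℕ) (M : ModuleCat.{u} R)
    [Module.Finite R M] : Module.Finite R ((tensorComplex P.complex M).homology i) := by
  induction i generalizing M with
  | zero =>
    have : Limits.PreservesFiniteColimits ((tensoringLeft (ModuleCat.{u} R)).obj M) :=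
      inferInstanceAs (Limits.PreservesFiniteColimits (tensorLeft M))
    let e : (tensorComplex P.complex M).homology 0 ≅ M ⊗ X :=
      (P.isoLeftDerivedObj ((tensoringLeft (ModuleCat.{u} R)).obj M) 0).symm ≪≫
        ((tensoringLeft (ModuleCat.{u} R)).obj M).leftDerivedZeroIsoSelf.app X
    have : Module.Finite R (M ⊗ X : ModuleCat.{u} R) :=
      inferInstanceAs (Module.Finite R (TensorProduct R M X))
    exact Module.Finite.equiv e.toLinearEquiv.symm
  | succ i ih =>
    obtain ⟨k, f, hf⟩ := Module.Finite.exists_fin' R M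
    have hE := tensorShortComplex_shortExact P.complex (LinearMap.shortExact_shortComplexKer hf)
    have := hE.mono_δ (i + 1) i (by simp)
      (isZero_homology_tensorComplex_of_flat P (ModuleCat.of R (Fin k → R)) i)
    have hker : Module.Finite R
        ((tensorShortComplex P.complex f.shortComplexKer).X₁.homology i) :=
      ih (ModuleCat.of R (LinearMap.ker f))
    exact Module.Finite.of_injective (hE.δ (i + 1) i (by simp)).hom
      ((ModuleCat.mono_iff_injective _).1 this)

variable {K : Type u} [Field K] [Algebra K R]

theorem finrank_restrictScalars_eq {A B : Type*} [AddCommGroup A] [AddCommGroup B]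
    [Module R A] [Module R B] (e : A ≃ₗ[R] B) :
    Module.finrank K (RestrictScalars K R A) = Module.finrank K (RestrictScalars K R B) :=
  LinearEquiv.finrank_eq
    { ((RestrictScalars.addEquiv K R A).trans e.toAddEquiv).trans
        (RestrictScalars.addEquiv K R B).symm with
      map_smul' := fun c y => e.map_smul (algebraMap K R c) y }

theorem finrank_restrictScalars_of_exact {A B C : Type*} [AddCommGroup A] [AddCommGroup B]
    [AddCommGroup C] [Module R A] [Module R B] [Module R C]
    [Module.Finite K (RestrictScalars K R B)] (f : A →ₗ[R] B) (g : B →ₗ[R] C)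
    (hf : Function.Injective f) (hg : Function.Surjective g) (hfg : Function.Exact f g) :
    Module.finrank K (RestrictScalars K R B) =
      Module.finrank K (RestrictScalars K R A) + Module.finrank K (RestrictScalars K R C) := by
  let _ : Module K A := Module.compHom A (algebraMap K R)
  let _ : Module K B := Module.compHom B (algebraMap K R)
  let _ : Module K C := Module.compHom C (algebraMap K R)
  have hfin : Module.Finite K B := ‹Module.Finite K (RestrictScalars K R B)›
  let f' : A →ₗ[K] B :=
    { f with map_smul' := fun c y => f.map_smul (algebraMap K R c) y }
  let g' : B →ₗ[K] C :=
    { g with map_smul' := fun c y => g.map_smul (algebraMap K R c) y }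
  have hfg' : Function.Exact f' g' := hfg
  have h := g'.finrank_range_add_finrank_ker
  rw [(LinearMap.range_eq_top (f := g')).2 hg, finrank_top, add_comm, hfg'.linearMap_ker_eq,
    LinearMap.finrank_range_of_inj (f := f') hf] at h
  exact h.symm

variable {X : ModuleCat.{u} R} (P : ProjectiveResolution X) {M N : ModuleCat.{u} R} {x : R}
  {g : M ⟶ N} {w : (x • 𝟙 M) ≫ g = 0}

theorem finrank_homology_zero_of_shortExact (hx : ∀ z : X, x • z = 0)
    (hE : (ShortComplex.mk (x • 𝟙 M) g w).ShortExact) :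
    Module.finrank K (RestrictScalars K R ((tensorComplex P.complex N).homology 0)) =
      Module.finrank K (RestrictScalars K R ((tensorComplex P.complex M).homology 0)) := by
  have hT := tensorShortComplex_shortExact P.complex hE
  have h0 := homologyMap_tensorComplexMap_smul P (M := M) 0 hx
  have hmono : Mono (HomologicalComplex.homologyMap (tensorComplexMap P.complex g) 0) :=
    (hT.homology_exact₂ 0).mono_g h0
  have hepi : Epi (HomologicalComplex.homologyMap (tensorComplexMap P.complex g) 0) := by
    have : Epi (tensorComplexMap P.complex g) := hT.epi_g
    exact HomologicalComplex.epi_homologyMap_of_epi_of_not_rel (tensorComplexMap P.complex g) 0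
      (by simp)
  exact (finrank_restrictScalars_eq (LinearEquiv.ofBijective
    (HomologicalComplex.homologyMap (tensorComplexMap P.complex g) 0).hom
      ⟨(ModuleCat.mono_iff_injective _).1 hmono, (ModuleCat.epi_iff_surjective _).1 hepi⟩)).symm

/-- Multiplication by `x` is zero on homology, so the long exact sequence breaks into short ones. -/
theorem finrank_homology_succ_of_shortExact (hx : ∀ z : X, x • z = 0)
    (hE : (ShortComplex.mk (x • 𝟙 M) g w).ShortExact) (i : ℕ)
    [Module.Finite K (RestrictScalars K R ((tensorComplex P.complex N).homology (i + 1)))] :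
    Module.finrank K (RestrictScalars K R ((tensorComplex P.complex N).homology (i + 1))) =
      Module.finrank K (RestrictScalars K R ((tensorComplex P.complex M).homology (i + 1))) +
        Module.finrank K (RestrictScalars K R ((tensorComplex P.complex M).homology i)) := by
  have hT := tensorShortComplex_shortExact P.complex hE
  have hrel : (ComplexShape.down ℕ).Rel (i + 1) i := by simp
  have hmono : Mono (HomologicalComplex.homologyMap (tensorComplexMap P.complex g) (i + 1)) :=
    (hT.homology_exact₂ (i + 1)).mono_g (homologyMap_tensorComplexMap_smul P (M := M) _ hx)
  have hepi : Epi (hT.δ (i + 1) i hrel) :=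
    (hT.homology_exact₁ (i + 1) i hrel).epi_f (homologyMap_tensorComplexMap_smul P (M := M) _ hx)
  exact finrank_restrictScalars_of_exact
    (HomologicalComplex.homologyMap (tensorComplexMap P.complex g) (i + 1)).hom
    (hT.δ (i + 1) i hrel).hom ((ModuleCat.mono_iff_injective _).1 hmono)
    ((ModuleCat.epi_iff_surjective _).1 hepi)
    ((ShortComplex.ShortExact.moduleCat_exact_iff_function_exact _).1
      (hT.homology_exact₃ (i + 1) i hrel))

end TorSequence

/-! ### Betti numbers and reduction modulo a non-zero-divisor -/

section BettiNumbers

variable {K : Type u} [Field K] {r : ℕ}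

theorem smul_residueModule {x : MvPolynomial (Fin r) K}
    (hx : x ∈ Ideal.span (Set.range (MvPolynomial.X : Fin r → MvPolynomial (Fin r) K)))
    (z : residueModule K r) : x • z = 0 := by
  obtain ⟨y, rfl⟩ := Ideal.Quotient.mk_surjective z
  exact Ideal.Quotient.eq_zero_iff_mem.2 (Ideal.mul_mem_right y _ hx)

theorem finite_restrictScalars_of_smul_eq_zero {V : Type*} [AddCommGroup V]
    [Module (MvPolynomial (Fin r) K) V] [Module.Finite (MvPolynomial (Fin r) K) V]
    (hV : ∀ (k : Fin r) (v : V), (MvPolynomial.X k : MvPolynomial (Fin r) K) • v = 0) :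
    Module.Finite K (RestrictScalars K (MvPolynomial (Fin r) K) V) := by
  obtain ⟨G, hG⟩ := (Module.Finite.fg_top : (⊤ : Submodule (MvPolynomial (Fin r) K) V).FG)
  -- The ring acts through constant coefficients, so module generators also span over `K`.
  have key : ∀ (p : MvPolynomial (Fin r) K) (v : V),
      p • v = (MvPolynomial.C (MvPolynomial.constantCoeff p) : MvPolynomial (Fin r) K) • v := by
    intro p v
    induction p using MvPolynomial.induction_on with
    | C c => simp
    | add p q hp hq => rw [add_smul, hp, hq, map_add, map_add, add_smul]
    | mul_X p k hp => rw [mul_smul, hV, smul_zero]; simp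
  let G' : Set (RestrictScalars K (MvPolynomial (Fin r) K) V) :=
    (RestrictScalars.addEquiv K (MvPolynomial (Fin r) K) V).symm '' (G : Set V)
  refine ⟨Submodule.fg_def.2 ⟨G', G.finite_toSet.image _, eq_top_iff.2 fun v _ => ?_⟩⟩
  have hv : RestrictScalars.addEquiv K (MvPolynomial (Fin r) K) V v ∈
      Submodule.span (MvPolynomial (Fin r) K) (G : Set V) := hG ▸ Submodule.mem_top
  have : ∀ y ∈ Submodule.span (MvPolynomial (Fin r) K) (G : Set V),
      (RestrictScalars.addEquiv K (MvPolynomial (Fin r) K) V).symm y ∈ Submodule.span K G' := by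
    intro y hy
    induction hy using Submodule.span_induction with
    | mem y hy => exact Submodule.subset_span ⟨y, hy, rfl⟩
    | zero => simp
    | add y z _ _ hy hz => rw [map_add]; exact add_mem hy hz
    | smul p y _ hy =>
      rw [key]
      exact Submodule.smul_mem _ (MvPolynomial.constantCoeff p) hy
  exact this _ hv

/-- The module `(I + (x)) / (x)`. -/
def residualModule (I : Ideal (MvPolynomial (Fin r) K)) (x : MvPolynomial (Fin r) K) :
    ModuleCat.{u} (MvPolynomial (Fin r) K) :=
  ModuleCat.of _ (Submodule.map (Submodule.mkQ (Ideal.span {x})) I)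

/-- The quotient map `I ⟶ (I + (x)) / (x)`. -/
def toResidualModule (I : Ideal (MvPolynomial (Fin r) K)) (x : MvPolynomial (Fin r) K) :
    ModuleCat.of (MvPolynomial (Fin r) K) I ⟶ residualModule I x :=
  ModuleCat.ofHom ((Submodule.mkQ (Ideal.span {x})).submoduleMap I)

theorem residualModule_congr {I J : Ideal (MvPolynomial (Fin r) K)} {x : MvPolynomial (Fin r) K}
    (h : I ⊔ Ideal.span {x} = J ⊔ Ideal.span {x}) : residualModule I x = residualModule J x := by
  have key : ∀ I : Ideal (MvPolynomial (Fin r) K),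
      Submodule.map (Submodule.mkQ (Ideal.span {x})) I =
        Submodule.map (Submodule.mkQ (Ideal.span {x})) (I ⊔ Ideal.span {x}) := by
    intro I
    rw [Submodule.map_sup, Submodule.mkQ_map_self, sup_bot_eq]
  rw [residualModule, residualModule, key I, key J, h]

theorem smul_comp_toResidualModule (I : Ideal (MvPolynomial (Fin r) K))
    (x : MvPolynomial (Fin r) K) :
    (x • 𝟙 (ModuleCat.of (MvPolynomial (Fin r) K) I)) ≫ toResidualModule I x = 0 := by
  ext z
  apply Subtype.ext
  exact (Submodule.Quotient.mk_eq_zero _).2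
    (Ideal.mul_mem_right _ _ (Ideal.mem_span_singleton_self x))

theorem shortExact_toResidualModule {I : Ideal (MvPolynomial (Fin r) K)}
    {x : MvPolynomial (Fin r) K} (hx : x ≠ 0) (hI : ∀ f, x * f ∈ I → f ∈ I) :
    (ShortComplex.mk _ _ (smul_comp_toResidualModule I x)).ShortExact := by
  apply ModuleCat.shortComplex_shortExact
  · intro z
    constructor
    · intro hz
      have hz' : (z : MvPolynomial (Fin r) K) ∈ Ideal.span {x} :=
        (Submodule.Quotient.mk_eq_zero _).1 (congrArg Subtype.val hz)
      obtain ⟨y, hy⟩ := Ideal.mem_span_singleton'.1 hz'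
      refine ⟨⟨y, hI y ?_⟩, ?_⟩
      · rw [mul_comm, hy]; exact z.2
      · apply Subtype.ext
        exact (mul_comm x y).trans hy
    · rintro ⟨y, rfl⟩
      exact congrArg (fun φ => φ.hom y) (smul_comp_toResidualModule I x)
  · intro y z hyz
    apply Subtype.ext
    exact mul_left_cancel₀ hx (congrArg Subtype.val hyz)
  · exact LinearMap.submoduleMap_surjective _ I

theorem bettiNumber_eq_finrank_homology (I : Ideal (MvPolynomial (Fin r) K)) (i : ℕ) :
    bettiNumber i I = Module.finrank K (RestrictScalars K (MvPolynomial (Fin r) K)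
      ((tensorComplex (projectiveResolution (residueModule K r)).complex
        (ModuleCat.of _ I)).homology i)) :=
  finrank_restrictScalars_eq
    ((projectiveResolution (residueModule K r)).isoLeftDerivedObj _ i).toLinearEquiv

/-- If `x` is a non-zero-divisor modulo two ideals with the same image modulo `x`, then these
ideals have the same Betti numbers. -/
theorem bettiNumber_eq_of_sup_span_eq {I J : Ideal (MvPolynomial (Fin r) K)}
    {x : MvPolynomial (Fin r) K} (hx : x ≠ 0)
    (hxm : x ∈ Ideal.span (Set.range (MvPolynomial.X : Fin r → MvPolynomial (Fin r) K)))
    (hI : ∀ f, x * f ∈ I → f ∈ I) (hJ : ∀ f, x * f ∈ J → f ∈ J)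
    (h : I ⊔ Ideal.span {x} = J ⊔ Ideal.span {x}) (i : ℕ) : bettiNumber i I = bettiNumber i J := by
  have hfin : Module.Finite (MvPolynomial (Fin r) K) (residueModule K r) :=
    inferInstanceAs (Module.Finite (MvPolynomial (Fin r) K) (MvPolynomial (Fin r) K ⧸
      Ideal.span (Set.range (MvPolynomial.X : Fin r → MvPolynomial (Fin r) K))))
  have hres : ∀ I : Ideal (MvPolynomial (Fin r) K),
      Module.Finite (MvPolynomial (Fin r) K) (residualModule I x) := fun I =>
    inferInstanceAs (Module.Finite _ (Submodule.map (Submodule.mkQ (Ideal.span {x})) I))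
  -- Additivity of `finrank` needs finite dimension, as `finrank` is `0` on infinite-dimensional
  -- spaces.
  have hK : ∀ (I : Ideal (MvPolynomial (Fin r) K)) (i : ℕ),
      Module.Finite K (RestrictScalars K (MvPolynomial (Fin r) K)
        ((tensorComplex (projectiveResolution (residueModule K r)).complex
          (residualModule I x)).homology i)) := by
    intro I i
    have := finite_homology_tensorComplex (projectiveResolution (residueModule K r)) i
      (residualModule I x)
    exact finite_restrictScalars_of_smul_eq_zero fun k v =>
      smul_homology_tensorComplex _ _ i
        (smul_residueModule (Ideal.subset_span (Set.mem_range_self k))) v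
  have hI' := shortExact_toResidualModule hx hI
  have hJ' := shortExact_toResidualModule hx hJ
  have hx' := smul_residueModule hxm
  induction i with
  | zero =>
    rw [bettiNumber_eq_finrank_homology, bettiNumber_eq_finrank_homology,
      ← finrank_homology_zero_of_shortExact _ hx' hI',
      ← finrank_homology_zero_of_shortExact _ hx' hJ', residualModule_congr h]
  | succ i ih =>
    have h1 := finrank_homology_succ_of_shortExact (K := K)
      (projectiveResolution (residueModule K r)) hx' hI' i
    have h2 := finrank_homology_succ_of_shortExact (K := K)
      (projectiveResolution (residueModule K r)) hx' hJ' i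
    -- Both sums of consecutive Betti numbers, in degrees `i + 1` and `i`, agree; the induction
    -- hypothesis cancels the lower terms.
    rw [residualModule_congr h, h2] at h1
    simp only [← bettiNumber_eq_finrank_homology] at h1
    omega

end BettiNumbers

/-! ### Normal forms of monomials modulo the scroll relations -/

section ScrollMonomials

variable {R : Type*} [CommRing R]

/-- The product of `D` of the elements `y 0, …, y n` whose indices sum to `s`, where as many
factors as possible are equal to `y n`. -/
def scrollMonomial (n : ℕ) (y : ℕ → R) : ℕ → ℕ → R
  | 0, _ => 1
  | D + 1, s => y (min s n) * scrollMonomial n y D (s - n)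

/-- The `2 × 2` minors of the matrix with rows `y 0, …, y (n - 1)` and `y 1, …, y n` vanish. -/
def SatisfiesScroll (n : ℕ) (y : ℕ → R) : Prop :=
  ∀ i j, i < n → j < n → y i * y (j + 1) = y (i + 1) * y j

variable {n : ℕ} {y : ℕ → R}

theorem SatisfiesScroll.shift (hy : SatisfiesScroll n y) (t : ℕ) :
    ∀ i l, i + t ≤ n → l + t ≤ n → y i * y (l + t) = y (i + t) * y l := by
  induction t with
  | zero => intro i l _ _; rfl
  | succ t ih =>
    intro i l hi hl
    rw [← add_assoc, hy i (l + t) (by omega) (by omega), ih (i + 1) l (by omega) (by omega),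
      show i + 1 + t = i + (t + 1) by omega]

theorem SatisfiesScroll.mul_eq_mul (hy : SatisfiesScroll n y) {i j k l : ℕ} (hi : i ≤ n)
    (hj : j ≤ n) (hk : k ≤ n) (hl : l ≤ n) (h : i + j = k + l) : y i * y j = y k * y l := by
  rcases le_total i k with hik | hik
  · obtain ⟨t, rfl⟩ := Nat.exists_eq_add_of_le hik
    obtain rfl : j = l + t := by omega
    exact hy.shift t i l hk hj
  · obtain ⟨t, rfl⟩ := Nat.exists_eq_add_of_le hik
    obtain rfl : l = j + t := by omega
    exact (hy.shift t k j hi hl).symm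

/-- The new factor is merged with the leading one: their product is rewritten with the first index
as large as possible, and the leftover is passed to the remaining factors. -/
theorem SatisfiesScroll.mul_scrollMonomial (hy : SatisfiesScroll n y) (D : ℕ) :
    ∀ s i, s ≤ n * D → i ≤ n →
      y i * scrollMonomial n y D s = scrollMonomial n y (D + 1) (s + i) := by
  induction D with
  | zero =>
    intro s i hs hi
    obtain rfl : s = 0 := by omega
    simp [scrollMonomial, hi]
  | succ D ih =>
    intro s i hs hi
    rw [Nat.mul_succ] at hs
    rw [scrollMonomial, scrollMonomial, ← mul_assoc,
      hy.mul_eq_mul (k := min (s + i) n) (l := i + min s n - min (s + i) n) hi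
        (min_le_right _ _) (min_le_right _ _) (by omega) (by omega), mul_assoc,
      ih (s - n) _ (by omega) (by omega)]
    congr 2
    omega

theorem SatisfiesScroll.scrollMonomial_mul (hy : SatisfiesScroll n y) (D D' s' : ℕ)
    (hs' : s' ≤ n * D') :
    ∀ s, s ≤ n * D → scrollMonomial n y D s * scrollMonomial n y D' s' =
      scrollMonomial n y (D + D') (s + s') := by
  induction D with
  | zero =>
    intro s hs
    obtain rfl : s = 0 := by omega
    simp [scrollMonomial]
  | succ D ih =>
    intro s hs
    rw [Nat.mul_succ] at hs
    rw [scrollMonomial, mul_assoc, ih (s - n) (by omega),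
      hy.mul_scrollMonomial (D + D') _ _ (by rw [Nat.mul_add]; omega) (min_le_right _ _)]
    congr 1 <;> omega

theorem SatisfiesScroll.pow_eq_scrollMonomial (hy : SatisfiesScroll n y) {i : ℕ} (hi : i ≤ n)
    (k : ℕ) : y i ^ k = scrollMonomial n y k (k * i) := by
  induction k with
  | zero => simp [scrollMonomial]
  | succ k ih =>
    rw [pow_succ', ih, hy.mul_scrollMonomial _ _ _ (by rw [mul_comm]; gcongr) hi]
    congr 1
    ring

theorem SatisfiesScroll.pow_mul_eq_scrollMonomial (hy : SatisfiesScroll n y) {i j : ℕ}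
    (hi : i ≤ n) (hj : j ≤ n) (k : ℕ) :
    y i ^ k * y j = scrollMonomial n y (k + 1) (k * i + j) := by
  rw [hy.pow_eq_scrollMonomial hi, mul_comm,
    hy.mul_scrollMonomial _ _ _ (by rw [mul_comm]; gcongr) hj]

/-- Splits off the bidegree of `x_n ^ q * x_{b+i}`. The index `i` is the least one for which the
remaining sum `s'` still fits into `D'` factors. -/
theorem exists_scroll_decomposition {n q b D s : ℕ} (hb : 1 ≤ b) (hbn : b ≤ n) (hs : s ≤ n * D)
    (hm : q * n + b ≤ s) :
    ∃ i D' s', b + i ≤ n ∧ D = D' + (q + 1) ∧ s = s' + (q * n + (b + i)) ∧ s' ≤ n * D' := by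
  have hqD : q < D := by
    by_contra h
    have : n * D ≤ n * q := Nat.mul_le_mul_left n (by omega)
    rw [mul_comm q n] at hm
    omega
  obtain ⟨D', rfl⟩ := Nat.exists_eq_add_of_le' (Nat.succ_le_of_lt hqD)
  have e : n * (D' + (q + 1)) = n * D' + q * n + n := by ring
  simp only [Nat.succ_eq_add_one] at hs ⊢
  rw [e] at hs
  refine ⟨s - (q * n + b) - n * D', D', s - (q * n + b) - (s - (q * n + b) - n * D'), ?_, rfl,
    ?_, ?_⟩ <;> omega

theorem SatisfiesScroll.scrollMonomial_eq_zero (hy : SatisfiesScroll n y) {q b : ℕ} (hb : 1 ≤ b)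
    (hbn : b ≤ n) (hq : ∀ i, b + i ≤ n → y n ^ q * y (b + i) = 0) {D s : ℕ} (hs : s ≤ n * D)
    (hm : q * n + b ≤ s) : scrollMonomial n y D s = 0 := by
  obtain ⟨i, D', s', hi, rfl, rfl, hs'⟩ := exists_scroll_decomposition hb hbn hs hm
  rw [← hy.scrollMonomial_mul D' (q + 1) _ (by rw [Nat.mul_succ, mul_comm n q]; omega) s' hs',
    ← hy.pow_mul_eq_scrollMonomial le_rfl hi, hq i hi, mul_zero]

theorem SatisfiesScroll.scrollMonomial_eq_reduce (hy : SatisfiesScroll n y) {q b e : ℕ}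
    (hb : 1 ≤ b) (hbn : b ≤ n)
    (hq : ∀ i, b + i ≤ n → y n ^ q * y (b + i) = y 0 ^ (q + e) * y i) {D s : ℕ} (hs : s ≤ n * D)
    (hm : q * n + b ≤ s) :
    scrollMonomial n y D s = scrollMonomial n y (D + e) (s - (q * n + b)) := by
  obtain ⟨i, D', s', hi, rfl, rfl, hs'⟩ := exists_scroll_decomposition hb hbn hs hm
  rw [← hy.scrollMonomial_mul D' (q + 1) _ (by rw [Nat.mul_succ, mul_comm n q]; omega) s' hs',
    ← hy.pow_mul_eq_scrollMonomial le_rfl hi, hq i hi,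
    hy.pow_mul_eq_scrollMonomial (Nat.zero_le n) (by omega),
    hy.scrollMonomial_mul D' _ _ (by rw [Nat.mul_succ]; omega) s' hs']
  congr 1 <;> omega

theorem SatisfiesScroll.scrollMonomial_eq_iterate (hy : SatisfiesScroll n y) {q b e : ℕ}
    (hb : 1 ≤ b) (hbn : b ≤ n)
    (hq : ∀ i, b + i ≤ n → y n ^ q * y (b + i) = y 0 ^ (q + e) * y i) {D s : ℕ} (k : ℕ)
    (hs : s + k * (q * n + b) ≤ n * D) :
    scrollMonomial n y D (s + k * (q * n + b)) = scrollMonomial n y (D + k * e) s := by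
  induction k generalizing D with
  | zero => simp
  | succ k ih =>
    rw [Nat.succ_mul] at hs
    rw [Nat.succ_mul, hy.scrollMonomial_eq_reduce hb hbn hq hs (by omega),
      show s + (k * (q * n + b) + (q * n + b)) - (q * n + b) = s + k * (q * n + b) by omega,
      ih (by rw [Nat.mul_add n D e]; omega)]
    congr 1
    ring

end ScrollMonomials

/-! ### Bidegrees, weights and sums of coefficients -/

section Exponents

variable {n : ℕ}

/-- The sum of the indices of the variables of a monomial, with multiplicity, where the
variables are indexed from zero. -/
def indexSum (n : ℕ) : (Fin (n + 1) →₀ ℕ) →+ ℕ :=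
  Finsupp.weight fun i : Fin (n + 1) => (i : ℕ)

@[simp]
theorem indexSum_single (i : Fin (n + 1)) (k : ℕ) : indexSum n (Finsupp.single i k) = k * i := by
  simp [indexSum, Finsupp.weight_single]

theorem indexSum_le (u : Fin (n + 1) →₀ ℕ) : indexSum n u ≤ n * u.degree := by
  induction u using Finsupp.induction_linear with
  | zero => simp
  | add u v hu hv => rw [map_add, map_add, mul_add]; omega
  | single i k =>
    rw [indexSum_single, Finsupp.degree_single, mul_comm]
    exact Nat.mul_le_mul_right _ (by omega)

theorem weight_eq_of_arithmetic {a : Fin (n + 1) → ℕ} {a₀ d : ℕ} (ha : ∀ i, a i = a₀ + i * d)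
    (u : Fin (n + 1) →₀ ℕ) : Finsupp.weight a u = a₀ * u.degree + d * indexSum n u := by
  induction u using Finsupp.induction_linear with
  | zero => simp
  | add u v hu hv => rw [map_add, map_add, map_add, hu, hv]; ring
  | single i k =>
    rw [indexSum_single, Finsupp.degree_single, Finsupp.weight_single, ha, smul_eq_mul]
    ring

variable {K : Type u} [Field K]

theorem map_monomial_eq_scrollMonomial {R : Type*} [CommRing R]
    (φ : MvPolynomial (Fin (n + 1)) K →+* R) {y : ℕ → R} (hφ : ∀ i, φ (MvPolynomial.X i) = y i)
    (hy : SatisfiesScroll n y) (u : Fin (n + 1) →₀ ℕ) :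
    φ (MvPolynomial.monomial u 1) = scrollMonomial n y u.degree (indexSum n u) := by
  induction u using Finsupp.induction_linear with
  | zero => simp [scrollMonomial]
  | add u v hu hv =>
    rw [← one_mul (1 : K), ← MvPolynomial.monomial_mul, map_mul, hu, hv,
      hy.scrollMonomial_mul _ _ _ (indexSum_le v) _ (indexSum_le u), map_add, map_add]
  | single i k =>
    rw [← MvPolynomial.X_pow_eq_monomial, map_pow, hφ, indexSum_single, Finsupp.degree_single,
      hy.pow_eq_scrollMonomial (by omega)]

/-- Tool for proving membership in an ideal: when the class of a monomial depends only on a key `κ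
u`, the terms can be grouped by key. -/
theorem sum_coeff_smul_eq_zero {R A : Type*} [AddCommGroup R] [Module K R] [DecidableEq A]
    (f : MvPolynomial (Fin (n + 1)) K) (κ : (Fin (n + 1) →₀ ℕ) → A) (c : A → R)
    (h : ∀ k, c k = 0 ∨ ∑ u ∈ f.support with κ u = k, f.coeff u = 0) :
    ∑ u ∈ f.support, f.coeff u • c (κ u) = 0 := by
  rw [← Finset.sum_fiberwise_of_maps_to (t := f.support.image κ) (g := κ)
    fun u hu => Finset.mem_image_of_mem κ hu]
  refine Finset.sum_eq_zero fun k _ => ?_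
  have : ∑ u ∈ f.support with κ u = k, f.coeff u • c (κ u) =
      (∑ u ∈ f.support with κ u = k, f.coeff u) • c k := by
    rw [Finset.sum_smul]
    refine Finset.sum_congr rfl fun u hu => ?_
    rw [(Finset.mem_filter.1 hu).2]
  rw [this]
  rcases h k with h | h <;> simp [h]

theorem mk_eq_sum (J : Ideal (MvPolynomial (Fin (n + 1)) K)) (f : MvPolynomial (Fin (n + 1)) K) :
    Ideal.Quotient.mk J f =
      ∑ u ∈ f.support, f.coeff u • Ideal.Quotient.mk J (MvPolynomial.monomial u 1) := by
  conv_lhs => rw [f.as_sum, map_sum]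
  refine Finset.sum_congr rfl fun u _ => ?_
  rw [← Ideal.Quotient.mkₐ_eq_mk K J, ← map_smul, MvPolynomial.smul_monomial, smul_eq_mul, mul_one]

theorem coeff_aeval_X_pow (a : Fin (n + 1) → ℕ) (f : MvPolynomial (Fin (n + 1)) K) (w : ℕ) :
    (MvPolynomial.aeval (fun i => (Polynomial.X : Polynomial K) ^ a i) f).coeff w =
      ∑ u ∈ f.support with Finsupp.weight a u = w, f.coeff u := by
  have h : ∀ u c, MvPolynomial.aeval (fun i => (Polynomial.X : Polynomial K) ^ a i)
      (MvPolynomial.monomial u c) = Polynomial.monomial (Finsupp.weight a u) c := by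
    intro u c
    rw [MvPolynomial.aeval_monomial, Finsupp.weight_apply, ← Polynomial.C_mul_X_pow_eq_monomial]
    simp only [Finsupp.prod, Finsupp.sum, ← pow_mul, Finset.prod_pow_eq_pow_sum, smul_eq_mul,
      mul_comm]
    rfl
  conv_lhs => rw [f.as_sum, map_sum, Polynomial.finsetSum_coeff]
  simp only [h, Polynomial.coeff_monomial, Finset.sum_filter]

/-- The map `x_i ↦ s * t ^ i` to `K[t][s]`, where the variables are indexed from zero. -/
def toScroll (K : Type u) [Field K] (n : ℕ) :
    MvPolynomial (Fin (n + 1)) K →ₐ[K] Polynomial (Polynomial K) :=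
  MvPolynomial.aeval fun i => Polynomial.X * Polynomial.C (Polynomial.X ^ (i : ℕ))

theorem toScroll_monomial (u : Fin (n + 1) →₀ ℕ) (c : K) :
    toScroll K n (MvPolynomial.monomial u c) =
      Polynomial.monomial u.degree (Polynomial.monomial (indexSum n u) c) := by
  induction u using Finsupp.induction_linear generalizing c with
  | zero => simp [toScroll]
  | add u v hu hv =>
    rw [← one_mul c, ← MvPolynomial.monomial_mul, map_mul, hu, hv, Polynomial.monomial_mul_monomial,
      Polynomial.monomial_mul_monomial, map_add, map_add]
  | single i k =>
    rw [MvPolynomial.monomial_eq, Finsupp.prod_single_index (by simp), map_mul, map_pow]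
    simp only [toScroll, MvPolynomial.aeval_X, MvPolynomial.aeval_C, indexSum_single,
      Finsupp.degree_single, mul_pow, ← Polynomial.C_mul_X_pow_eq_monomial, ← Polynomial.C_pow,
      ← pow_mul, map_mul]
    rw [mul_comm (i : ℕ) k, mul_comm (Polynomial.X ^ k) (Polynomial.C _), ← mul_assoc]
    rfl

theorem coeff_coeff_toScroll (f : MvPolynomial (Fin (n + 1)) K) (D s : ℕ) :
    ((toScroll K n f).coeff D).coeff s =
      ∑ u ∈ f.support with (u.degree, indexSum n u) = (D, s), f.coeff u := by
  conv_lhs => rw [f.as_sum, map_sum, Polynomial.finsetSum_coeff, Polynomial.finsetSum_coeff]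
  rw [Finset.sum_filter]
  refine Finset.sum_congr rfl fun u _ => ?_
  rw [toScroll_monomial, Polynomial.coeff_monomial]
  simp only [Prod.mk.injEq]
  split_ifs <;> simp_all [Polynomial.coeff_monomial]

end Exponents

/-! ### The binomials generate the semigroup ideal -/

section Generation

variable {K : Type u} [Field K] {n : ℕ}

theorem ofNat_natCast_eq (i : Fin (n + 1)) : Fin.ofNat (n + 1) (i : ℕ) = i := by
  ext
  simp

theorem satisfiesScroll_of_map_eq_zero {R : Type*} [CommRing R]
    (φ : MvPolynomial (Fin (n + 1)) K →+* R) (hφ : ∀ f ∈ scrollMinors K n, φ f = 0) :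
    SatisfiesScroll n fun i => φ (MvPolynomial.X (Fin.ofNat (n + 1) i)) := by
  have key : ∀ i j, i < j → j < n →
      φ (MvPolynomial.X (Fin.ofNat (n + 1) i)) * φ (MvPolynomial.X (Fin.ofNat (n + 1) (j + 1))) =
        φ (MvPolynomial.X (Fin.ofNat (n + 1) (i + 1))) *
          φ (MvPolynomial.X (Fin.ofNat (n + 1) j)) := by
    intro i j hij hj
    have h := hφ _ ⟨⟨i, hij.trans hj⟩, ⟨j, hj⟩, hij, rfl⟩
    rw [map_sub, map_mul, map_mul, sub_eq_zero] at h
    rw [← ofNat_natCast_eq (Fin.castSucc _), ← ofNat_natCast_eq (Fin.succ ⟨j, hj⟩),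
      ← ofNat_natCast_eq (Fin.succ ⟨i, _⟩), ← ofNat_natCast_eq (Fin.castSucc ⟨j, hj⟩)] at h
    exact h
  intro i j hi hj
  rcases lt_trichotomy i j with h | rfl | h
  · exact key i j h hj
  · exact mul_comm _ _
  · rw [mul_comm, ← key j i h hi, mul_comm]

theorem mem_semigroupIdeal_iff {a : Fin (n + 1) → ℕ} {f : MvPolynomial (Fin (n + 1)) K} :
    f ∈ semigroupIdeal K a ↔
      ∀ w, ∑ u ∈ f.support with Finsupp.weight a u = w, f.coeff u = 0 := by
  rw [semigroupIdeal, RingHom.mem_ker, Polynomial.ext_iff]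
  exact forall_congr' fun w => by
    rw [Polynomial.coeff_zero, ← coeff_aeval_X_pow]

/-- Numerical data attached to an arithmetic sequence `a` of `n + 1` terms with difference `d`. -/
structure ArithmeticData (a : Fin (n + 1) → ℕ) (d g m e q b : ℕ) : Prop where
  apply_eq : ∀ i, a i = a 0 + i * d
  zero_eq : a 0 = g * m
  diff_eq : d = g * e
  g_pos : 0 < g
  e_pos : 0 < e
  coprime : Nat.Coprime m e
  m_eq : m = q * n + b
  q_pos : 0 < q
  one_le_b : 1 ≤ b
  b_le : b ≤ n

variable {a : Fin (n + 1) → ℕ} {d g m e q b : ℕ}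

theorem ArithmeticData.weight_eq (h : ArithmeticData a d g m e q b) (u : Fin (n + 1) →₀ ℕ) :
    Finsupp.weight a u = g * (m * u.degree + e * indexSum n u) := by
  rw [weight_eq_of_arithmetic h.apply_eq, h.zero_eq, h.diff_eq]
  ring

theorem ArithmeticData.arithmeticGenerators_subset (h : ArithmeticData a d g m e q b) :
    arithmeticGenerators K n q b e ⊆ semigroupIdeal K a := by
  rintro f (⟨i, j, hij, rfl⟩ | ⟨i, k, hk, rfl⟩)
  · simp only [SetLike.mem_coe, semigroupIdeal, RingHom.mem_ker, map_sub,
      map_mul, MvPolynomial.aeval_X, ← pow_add, sub_eq_zero]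
    congr 1
    simp only [h.apply_eq i.castSucc, h.apply_eq i.succ, h.apply_eq j.castSucc,
      h.apply_eq j.succ, Fin.val_castSucc, Fin.val_succ]
    ring
  · simp only [SetLike.mem_coe, semigroupIdeal, RingHom.mem_ker, map_sub,
      map_mul, map_pow, MvPolynomial.aeval_X, ← pow_add, ← pow_mul, sub_eq_zero]
    congr 1
    rw [h.apply_eq (Fin.last n), h.apply_eq k, h.apply_eq i, hk, Fin.val_last, h.zero_eq,
      h.diff_eq, h.m_eq]
    ring

/-- Coprimality of `m` and `e` forces the degrees to differ by `e * k` and the index sums by `k *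
m`; then `k` reductions by the extra binomials connect the normal forms. -/
theorem ArithmeticData.mk_monomial_eq (h : ArithmeticData a d g m e q b)
    {u v : Fin (n + 1) →₀ ℕ} (huv : Finsupp.weight a u = Finsupp.weight a v) :
    Ideal.Quotient.mk (Ideal.span (arithmeticGenerators K n q b e))
        (MvPolynomial.monomial u 1) =
      Ideal.Quotient.mk (Ideal.span (arithmeticGenerators K n q b e))
        (MvPolynomial.monomial v 1) := by
  wlog huv' : u.degree ≤ v.degree generalizing u v
  · exact (this huv.symm (le_of_not_ge huv')).symm
  set φ := Ideal.Quotient.mk (Ideal.span (arithmeticGenerators K n q b e)) with hφ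
  have hzero : ∀ f ∈ arithmeticGenerators K n q b e, φ f = 0 := fun f hf =>
    Ideal.Quotient.eq_zero_iff_mem.2 (Ideal.subset_span hf)
  have hy := satisfiesScroll_of_map_eq_zero φ fun f hf => hzero f (Or.inl hf)
  have hX : ∀ i : Fin (n + 1), φ (MvPolynomial.X i) =
      φ (MvPolynomial.X (Fin.ofNat (n + 1) (i : ℕ))) := fun i => by rw [ofNat_natCast_eq]
  have hq : ∀ i, b + i ≤ n → φ (MvPolynomial.X (Fin.ofNat (n + 1) n)) ^ q *
      φ (MvPolynomial.X (Fin.ofNat (n + 1) (b + i))) =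
        φ (MvPolynomial.X (Fin.ofNat (n + 1) 0)) ^ (q + e) *
          φ (MvPolynomial.X (Fin.ofNat (n + 1) i)) := by
    intro i hi
    have := hzero _ (Or.inr ⟨⟨i, by omega⟩, ⟨b + i, by omega⟩, rfl, rfl⟩)
    rw [map_sub, map_mul, map_mul, map_pow, map_pow, sub_eq_zero] at this
    rw [hX (Fin.last n), hX ⟨b + i, _⟩, hX 0, hX ⟨i, _⟩] at this
    exact this
  obtain ⟨c, hc⟩ := Nat.exists_eq_add_of_le huv'
  rw [h.weight_eq, h.weight_eq] at huv
  have huv := Nat.eq_of_mul_eq_mul_left h.g_pos huv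
  rw [hc] at huv
  have h1 : e * indexSum n u = m * c + e * indexSum n v := by nlinarith
  have hdvd : e ∣ m * c := (Nat.dvd_add_iff_left (dvd_mul_right e _)).2 (h1 ▸ dvd_mul_right e _)
  obtain ⟨k, rfl⟩ := h.coprime.symm.dvd_of_dvd_mul_left hdvd
  have h2 : indexSum n u = indexSum n v + k * m :=
    Nat.eq_of_mul_eq_mul_left h.e_pos (by rw [h1]; ring)
  have h3 := indexSum_le u
  rw [map_monomial_eq_scrollMonomial φ hX hy, map_monomial_eq_scrollMonomial φ hX hy, hc, h2,
    h.m_eq, hy.scrollMonomial_eq_iterate h.one_le_b h.b_le hq k (by rw [← h.m_eq, ← h2]; exact h3),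
    mul_comm e k]

theorem ArithmeticData.span_arithmeticGenerators (h : ArithmeticData a d g m e q b) :
    Ideal.span (arithmeticGenerators K n q b e) = semigroupIdeal K a := by
  classical
  refine le_antisymm (Ideal.span_le.2 h.arithmeticGenerators_subset) fun f hf => ?_
  rw [← Ideal.Quotient.eq_zero_iff_mem, mk_eq_sum]
  -- `c w` is the class of a chosen monomial of weight `w`; its value at weights that do not occur
  -- is irrelevant.
  let c : ℕ → MvPolynomial (Fin (n + 1)) K ⧸ Ideal.span (arithmeticGenerators K n q b e) :=
    fun w => Ideal.Quotient.mk _ (MvPolynomial.monomial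
      (Function.invFun (Finsupp.weight a : (Fin (n + 1) →₀ ℕ) → ℕ) w) 1)
  have hc : ∀ u, Ideal.Quotient.mk (Ideal.span (arithmeticGenerators K n q b e))
      (MvPolynomial.monomial u 1) = c (Finsupp.weight a u) := fun u =>
    h.mk_monomial_eq (Function.invFun_eq ⟨u, rfl⟩).symm
  simp only [hc]
  exact sum_coeff_smul_eq_zero f _ c fun w => Or.inr (mem_semigroupIdeal_iff.1 hf w)

end Generation

/-! ### Initial forms and the truncation ideal -/

section InitialIdeal

variable {K : Type u} [Field K] {n : ℕ}

theorem initialForm_add_eq {r : ℕ} {p t : MvPolynomial (Fin r) K} {D E : ℕ}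
    (hp : p.IsHomogeneous D) (hp0 : p ≠ 0) (ht : t.IsHomogeneous E) (hDE : D < E) :
    initialForm (p + t) = p := by
  have hcomp : ∀ k, k ≤ D → MvPolynomial.homogeneousComponent k (p + t) =
      if k = D then p else 0 := by
    intro k hk
    rw [map_add, MvPolynomial.homogeneousComponent_of_mem hp,
      MvPolynomial.homogeneousComponent_of_mem ht, if_neg (by omega : ¬ k = E), add_zero]
  have hD : MvPolynomial.homogeneousComponent D (p + t) ≠ 0 := by
    rwa [hcomp D le_rfl, if_pos rfl]
  have hdeg : initialDegree (p + t) = D := by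
    apply le_antisymm
    · exact Nat.sInf_le hD
    · refine le_csInf ⟨D, hD⟩ fun k hk => ?_
      by_contra hlt
      exact hk (by rw [hcomp k (by omega), if_neg (by omega)])
  rw [initialForm, hdeg, hcomp D le_rfl, if_pos rfl]

theorem initialForm_eq_self {r : ℕ} {p : MvPolynomial (Fin r) K} {D : ℕ}
    (hp : p.IsHomogeneous D) (hp0 : p ≠ 0) : initialForm p = p := by
  have := initialForm_add_eq hp hp0 (MvPolynomial.isHomogeneous_zero _ _ (D + 1)) (by omega)
  rwa [add_zero] at this

theorem coeff_eq_zero_of_degree_lt_initialDegree {r : ℕ} {f : MvPolynomial (Fin r) K}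
    {u : Fin r →₀ ℕ} (hu : u.degree < initialDegree f) : f.coeff u = 0 := by
  have := Nat.notMem_of_lt_sInf hu
  rw [Set.mem_ofPred_eq, not_not] at this
  have := congrArg (MvPolynomial.coeff u) this
  rwa [MvPolynomial.coeff_homogeneousComponent, if_pos rfl, MvPolynomial.coeff_zero] at this

/-- The polynomials whose image under `x_i ↦ s * t ^ i` is divisible by `t ^ m`. -/
def scrollTruncation (K : Type u) [Field K] (n m : ℕ) : Ideal (MvPolynomial (Fin (n + 1)) K) :=
  Ideal.comap (toScroll K n) (Ideal.span {Polynomial.C (Polynomial.X ^ m)})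

theorem mem_scrollTruncation_iff {m : ℕ} {f : MvPolynomial (Fin (n + 1)) K} :
    f ∈ scrollTruncation K n m ↔
      ∀ D s, s < m → ((toScroll K n f).coeff D).coeff s = 0 := by
  rw [scrollTruncation, Ideal.mem_comap, Ideal.mem_span_singleton, Polynomial.C_dvd_iff_dvd_coeff]
  exact forall_congr' fun D => Polynomial.X_pow_dvd_iff

/-- The variable `x_0` maps to `s`, which only shifts the outer coefficients and leaves divisibility
by `t ^ m` unchanged. -/
theorem mem_scrollTruncation_of_X_zero_mul_mem {m : ℕ} {f : MvPolynomial (Fin (n + 1)) K}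
    (hf : MvPolynomial.X 0 * f ∈ scrollTruncation K n m) : f ∈ scrollTruncation K n m := by
  rw [mem_scrollTruncation_iff] at hf ⊢
  intro D s hs
  have := hf (D + 1) s hs
  have hX : toScroll K n (MvPolynomial.X 0) = Polynomial.X := by simp [toScroll]
  rwa [map_mul, hX, Polynomial.coeff_X_mul] at this

variable {a : Fin (n + 1) → ℕ} {d g m e q b : ℕ}

/-- In the least degree `D` and for `s < m`, the terms of bidegree `(D, s)` are all the terms of `f`
of their weight: another one would have index sum `s - k * m` with `k > 0`. So their coefficients
sum to zero. -/
theorem ArithmeticData.initialForm_mem_scrollTruncation (h : ArithmeticData a d g m e q b)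
    {f : MvPolynomial (Fin (n + 1)) K} (hf : f ∈ semigroupIdeal K a) :
    initialForm f ∈ scrollTruncation K n m := by
  classical
  rw [mem_scrollTruncation_iff]
  intro D s hs
  rw [coeff_coeff_toScroll]
  by_cases hD : D = initialDegree f
  · rw [← mem_semigroupIdeal_iff.1 hf (g * (m * D + e * s))]
    have hL : ∑ u ∈ (initialForm f).support with (u.degree, indexSum n u) = (D, s),
        (initialForm f).coeff u =
        ∑ u ∈ f.support with (u.degree, indexSum n u) = (D, s), f.coeff u := by
      have hcoeff : ∀ u : Fin (n + 1) →₀ ℕ, u.degree = D → (initialForm f).coeff u = f.coeff u :=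
        fun u hu => by
          rw [initialForm, MvPolynomial.coeff_homogeneousComponent, if_pos (hu.trans hD)]
      refine Finset.sum_congr ?_ fun u hu => hcoeff u (congrArg Prod.fst (Finset.mem_filter.1 hu).2)
      ext u
      simp only [Finset.mem_filter, MvPolynomial.mem_support_iff, Prod.mk.injEq]
      refine and_congr_left fun hu => ?_
      rw [hcoeff u hu.1]
    rw [hL]
    refine Finset.sum_congr ?_ fun _ _ => rfl
    ext u
    simp only [Finset.mem_filter, MvPolynomial.mem_support_iff, Prod.mk.injEq]
    refine and_congr_right fun hu => ?_
    rw [h.weight_eq]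
    constructor
    · rintro ⟨rfl, rfl⟩; rfl
    · intro hw
      have hw := Nat.eq_of_mul_eq_mul_left h.g_pos hw
      have hdeg : D ≤ u.degree := by
        by_contra hlt
        exact hu (coeff_eq_zero_of_degree_lt_initialDegree (by omega))
      obtain ⟨c, hc⟩ := Nat.exists_eq_add_of_le hdeg
      rw [hc] at hw
      have h1 : e * s = m * c + e * indexSum n u := by nlinarith
      have hdvd : e ∣ m * c :=
        (Nat.dvd_add_iff_left (dvd_mul_right e _)).2 (h1 ▸ dvd_mul_right e _)
      obtain ⟨k, rfl⟩ := h.coprime.symm.dvd_of_dvd_mul_left hdvd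
      have h2 : s = indexSum n u + k * m :=
        Nat.eq_of_mul_eq_mul_left h.e_pos (by rw [h1]; ring)
      obtain rfl : k = 0 := by
        by_contra hk
        have : 1 * m ≤ k * m := Nat.mul_le_mul_right m (by omega)
        omega
      exact ⟨by simpa using hc, by simpa using h2.symm⟩
  · refine Finset.sum_eq_zero fun u hu => ?_
    have hu' := congrArg Prod.fst (Finset.mem_filter.1 hu).2
    rw [initialForm, MvPolynomial.coeff_homogeneousComponent, if_neg]
    exact fun hu'' => hD (hu'.symm.trans hu'')

end InitialIdeal

/-! ### Separating functionals and irredundancy -/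

section Minimality

variable {K : Type u} [Field K] {n : ℕ}

/-- The linear functional with prescribed values on the monomials. -/
def monomialFunctional {r : ℕ} (c : (Fin r →₀ ℕ) → K) : MvPolynomial (Fin r) K →ₗ[K] K :=
  (MvPolynomial.basisMonomials (Fin r) K).constr K c

theorem monomialFunctional_monomial {r : ℕ} (c : (Fin r →₀ ℕ) → K) (u : Fin r →₀ ℕ) (k : K) :
    monomialFunctional c (MvPolynomial.monomial u k) = k * c u := by
  have h : monomialFunctional c (MvPolynomial.monomial u 1) = c u := by
    have := (MvPolynomial.basisMonomials (Fin r) K).constr_basis K c u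
    rwa [MvPolynomial.coe_basisMonomials] at this
  rw [← h, ← smul_eq_mul, ← map_smul, MvPolynomial.smul_monomial, smul_eq_mul, mul_one]

theorem monomialFunctional_mul_binomial_eq_zero {r : ℕ} {c : (Fin r →₀ ℕ) → K}
    {u v : Fin r →₀ ℕ} (h : ∀ w, c (w + u) = c (w + v)) (p : MvPolynomial (Fin r) K) :
    monomialFunctional c
      (p * (MvPolynomial.monomial u 1 - MvPolynomial.monomial v 1)) = 0 := by
  induction p using MvPolynomial.induction_on' with
  | monomial w k =>
    rw [mul_sub, MvPolynomial.monomial_mul, MvPolynomial.monomial_mul, map_sub,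
      monomialFunctional_monomial, monomialFunctional_monomial, h, sub_self]
  | add p q hp hq => rw [add_mul, map_add, hp, hq, add_zero]

/-- A linear functional that vanishes on all multiples of the elements of `G` other than `f`,
but not on `f`. -/
def IsSeparating {r : ℕ} (G : Set (MvPolynomial (Fin r) K)) (f : MvPolynomial (Fin r) K)
    (φ : MvPolynomial (Fin r) K →ₗ[K] K) : Prop :=
  φ f ≠ 0 ∧ ∀ t ∈ G, t ≠ f → ∀ p, φ (p * t) = 0

theorem span_ne_of_ssubset {r : ℕ} {G T : Set (MvPolynomial (Fin r) K)}
    (hG : ∀ f ∈ G, ∃ φ, IsSeparating G f φ) (hT : T ⊂ G) : Ideal.span T ≠ Ideal.span G := by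
  obtain ⟨f, hfG, hfT⟩ := Set.exists_of_ssubset hT
  obtain ⟨φ, hφ, hφ'⟩ := hG f hfG
  intro h
  have hf : f ∈ Ideal.span T := h ▸ Ideal.subset_span hfG
  have key : ∀ t ∈ Ideal.span T, ∀ p, φ (p * t) = 0 := by
    intro t ht
    induction ht using Submodule.span_induction with
    | mem t ht => exact hφ' t (hT.1 ht) fun htf => hfT (htf ▸ ht)
    | zero => simp
    | add s t _ _ hs ht => intro p; rw [mul_add, map_add, hs, ht, add_zero]
    | smul s t _ ht => intro p; rw [smul_eq_mul, ← mul_assoc]; exact ht _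
  exact hφ (by simpa using key f hf 1)

theorem X_mul_X_eq_monomial (i j : Fin (n + 1)) :
    (MvPolynomial.X i * MvPolynomial.X j : MvPolynomial (Fin (n + 1)) K) =
      MvPolynomial.monomial (Finsupp.single i 1 + Finsupp.single j 1) 1 := by
  rw [MvPolynomial.X, MvPolynomial.X, MvPolynomial.monomial_mul, one_mul]

theorem X_pow_mul_X_eq_monomial (i j : Fin (n + 1)) (k : ℕ) :
    (MvPolynomial.X i ^ k * MvPolynomial.X j : MvPolynomial (Fin (n + 1)) K) =
      MvPolynomial.monomial (Finsupp.single i k + Finsupp.single j 1) 1 := by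
  rw [MvPolynomial.X_pow_eq_monomial, MvPolynomial.X, MvPolynomial.monomial_mul, one_mul]

variable {q b e : ℕ}

-- The functional sums the coefficients of the quadratic monomials of index sum `i + j + 1` with
-- both indices in `(i, j]`. Of the two monomials of the given minor only the second counts. Another
-- minor with the same index sum has both monomials inside or both outside, and the monomials of the
-- extra binomials involve `x_n` or `x_0`.
open Classical in
theorem exists_isSeparating_scrollMinor (hq : 0 < q) {i j : Fin n} (hij : i < j) :
    ∃ φ, IsSeparating (arithmeticGenerators K n q b e)
      (MvPolynomial.X i.castSucc * MvPolynomial.X j.succ -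
        MvPolynomial.X i.succ * MvPolynomial.X j.castSucc) φ := by
  let c : (Fin (n + 1) →₀ ℕ) → K := fun u =>
    if u.degree = 2 ∧ indexSum n u = i + j + 1 ∧ ∀ p, u p ≠ 0 → (i : ℕ) < p ∧ (p : ℕ) ≤ j then 1
    else 0
  have hij' : (i : ℕ) < j := hij
  have hpair : ∀ s t : Fin (n + 1), (∀ p, (Finsupp.single s 1 + Finsupp.single t 1 :
      Fin (n + 1) →₀ ℕ) p ≠ 0 → (i : ℕ) < p ∧ (p : ℕ) ≤ j) ↔
        ((i : ℕ) < s ∧ (s : ℕ) ≤ j) ∧ ((i : ℕ) < t ∧ (t : ℕ) ≤ j) := by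
    intro s t
    constructor
    · intro h
      exact ⟨h s (by simp), h t (by simp)⟩
    · rintro ⟨hs, ht⟩ p hp
      by_cases hps : p = s
      · rwa [hps]
      by_cases hpt : p = t
      · rwa [hpt]
      · simp [Ne.symm hps, Ne.symm hpt] at hp
  refine ⟨monomialFunctional c, ?_, ?_⟩
  · rw [X_mul_X_eq_monomial, X_mul_X_eq_monomial, map_sub, monomialFunctional_monomial,
      monomialFunctional_monomial]
    have h1 : c (Finsupp.single i.castSucc 1 + Finsupp.single j.succ 1) = 0 := by
      apply if_neg
      rw [hpair]
      simp
    have h2 : c (Finsupp.single i.succ 1 + Finsupp.single j.castSucc 1) = 1 := by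
      apply if_pos
      rw [hpair]
      simp only [map_add, Finsupp.degree_single, indexSum_single, Fin.val_succ, Fin.val_castSucc,
        true_and]
      omega
    simp [h1, h2]
  · rintro t (⟨i', j', hij₁, rfl⟩ | ⟨i', k', hk', rfl⟩) ht p
    · rw [X_mul_X_eq_monomial, X_mul_X_eq_monomial]
      apply monomialFunctional_mul_binomial_eq_zero
      intro w
      have hne : ¬ ((i' : ℕ) = i ∧ (j' : ℕ) = j) := by
        rintro ⟨h1, h2⟩
        exact ht (by rw [Fin.ext h1, Fin.ext h2])
      have hij₂ : (i' : ℕ) < j' := hij₁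
      rcases eq_or_ne w 0 with rfl | hw
      · have : (∀ p, (Finsupp.single i'.castSucc 1 + Finsupp.single j'.succ 1 :
            Fin (n + 1) →₀ ℕ) p ≠ 0 → (i : ℕ) < p ∧ (p : ℕ) ≤ j) ∧
            (i' : ℕ) + j' = i + j ↔ (∀ p, (Finsupp.single i'.succ 1 +
              Finsupp.single j'.castSucc 1 : Fin (n + 1) →₀ ℕ) p ≠ 0 →
                (i : ℕ) < p ∧ (p : ℕ) ≤ j) ∧ (i' : ℕ) + j' = i + j := by
          rw [hpair, hpair]
          simp only [Fin.val_succ, Fin.val_castSucc]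
          omega
        simp only [c, zero_add]
        refine if_congr ?_ rfl rfl
        simp only [map_add, Finsupp.degree_single, indexSum_single, Fin.val_succ,
          Fin.val_castSucc, true_and, one_mul]
        constructor
        · rintro ⟨h1, h2⟩
          exact ⟨by omega, (this.1 ⟨h2, by omega⟩).1⟩
        · rintro ⟨h1, h2⟩
          exact ⟨by omega, (this.2 ⟨h2, by omega⟩).1⟩
      · have hw' : w.degree ≠ 0 := by rwa [Ne, Finsupp.degree_eq_zero_iff]
        rw [show c _ = 0 from if_neg _, show c _ = 0 from if_neg _] <;>
        · rintro ⟨h, -⟩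
          simp only [map_add, Finsupp.degree_single] at h
          omega
    · rw [X_pow_mul_X_eq_monomial, X_pow_mul_X_eq_monomial]
      apply monomialFunctional_mul_binomial_eq_zero
      intro w
      rw [show c _ = 0 from if_neg _, show c _ = 0 from if_neg _]
      · rintro ⟨-, -, h⟩
        have := (h 0 (by simp; omega)).1
        simp at this
      · rintro ⟨-, -, h⟩
        have := (h (Fin.last n) (by simp; omega)).2
        simp only [Fin.val_last] at this
        omega

-- The functional sums the coefficients in the bidegree of `x_n ^ q * x_k`. Scroll minors are
-- bihomogeneous with coefficient sum zero; the leading monomials of the other extra binomials have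
-- a different index sum, and all trailing monomials have too large a degree.
open Classical in
theorem exists_isSeparating_extraMinor (he : 0 < e) {i k : Fin (n + 1)} (hk : (k : ℕ) = b + i) :
    ∃ φ, IsSeparating (arithmeticGenerators K n q b e)
      (MvPolynomial.X (Fin.last n) ^ q * MvPolynomial.X k -
        MvPolynomial.X 0 ^ (q + e) * MvPolynomial.X i) φ := by
  let c : (Fin (n + 1) →₀ ℕ) → K := fun u =>
    if u.degree = q + 1 ∧ indexSum n u = q * n + k then 1 else 0
  refine ⟨monomialFunctional c, ?_, ?_⟩
  · rw [X_pow_mul_X_eq_monomial, X_pow_mul_X_eq_monomial, map_sub, monomialFunctional_monomial,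
      monomialFunctional_monomial]
    have h1 : c (Finsupp.single (Fin.last n) q + Finsupp.single k 1) = 1 := by
      apply if_pos
      simp
    have h2 : c (Finsupp.single 0 (q + e) + Finsupp.single i 1) = 0 := by
      apply if_neg
      simp only [map_add, Finsupp.degree_single]
      omega
    rw [h1, h2]
    simp
  · rintro t (⟨i', j', hij, rfl⟩ | ⟨i', k', hk', rfl⟩) ht p
    · rw [X_mul_X_eq_monomial, X_mul_X_eq_monomial]
      apply monomialFunctional_mul_binomial_eq_zero
      intro w
      refine if_congr ?_ rfl rfl
      simp only [map_add, Finsupp.degree_single, indexSum_single, Fin.val_succ, Fin.val_castSucc]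
      omega
    · rw [X_pow_mul_X_eq_monomial, X_pow_mul_X_eq_monomial]
      apply monomialFunctional_mul_binomial_eq_zero
      intro w
      rw [show c _ = 0 from if_neg _, show c _ = 0 from if_neg _]
      · rintro ⟨h, -⟩
        simp only [map_add, Finsupp.degree_single] at h
        omega
      · rintro ⟨h, h'⟩
        simp only [map_add, Finsupp.degree_single] at h
        obtain rfl : w = 0 := by rw [← Finsupp.degree_eq_zero_iff]; omega
        simp only [map_add, indexSum_single, map_zero, Fin.val_last] at h'
        have hkk : k' = k := Fin.ext (by omega)
        have hii : i' = i := Fin.ext (by omega)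
        exact ht (by rw [hkk, hii])

theorem exists_isSeparating (hq : 0 < q) (he : 0 < e) {f : MvPolynomial (Fin (n + 1)) K}
    (hf : f ∈ arithmeticGenerators K n q b e) :
    ∃ φ, IsSeparating (arithmeticGenerators K n q b e) f φ := by
  obtain ⟨i, j, hij, rfl⟩ | ⟨i, k, hk, rfl⟩ := hf
  · exact exists_isSeparating_scrollMinor hq hij
  · exact exists_isSeparating_extraMinor he hk

theorem ne_zero_of_mem_arithmeticGenerators (hq : 0 < q) (he : 0 < e)
    {f : MvPolynomial (Fin (n + 1)) K} (hf : f ∈ arithmeticGenerators K n q b e) : f ≠ 0 := by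
  obtain ⟨φ, hφ, -⟩ := exists_isSeparating hq he hf
  rintro rfl
  exact hφ (map_zero φ)

end Minimality

/-! ### The standard basis, the Betti numbers and the numerical data -/

section StandardBasis

variable {K : Type u} [Field K] {n : ℕ} {a : Fin (n + 1) → ℕ} {d g m e q b : ℕ}

theorem finite_arithmeticGenerators : (arithmeticGenerators K n q b e).Finite := by
  refine Set.Finite.union ?_ ?_
  · refine (Set.finite_range fun p : Fin n × Fin n =>
      (MvPolynomial.X p.1.castSucc * MvPolynomial.X p.2.succ -
        MvPolynomial.X p.1.succ * MvPolynomial.X p.2.castSucc :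
          MvPolynomial (Fin (n + 1)) K)).subset ?_
    rintro f ⟨i, j, -, rfl⟩
    exact ⟨(i, j), rfl⟩
  · refine (Set.finite_range fun p : Fin (n + 1) × Fin (n + 1) =>
      (MvPolynomial.X (Fin.last n) ^ q * MvPolynomial.X p.2 -
        MvPolynomial.X 0 ^ (q + e) * MvPolynomial.X p.1 :
          MvPolynomial (Fin (n + 1)) K)).subset ?_
    rintro f ⟨i, k, -, rfl⟩
    exact ⟨(i, k), rfl⟩

theorem initialForm_scrollMinor {f : MvPolynomial (Fin (n + 1)) K} (hf : f ∈ scrollMinors K n) :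
    initialForm f = f := by
  have hf0 : f ≠ 0 := ne_zero_of_mem_arithmeticGenerators (q := 1) (b := 0) one_pos one_pos
    (Or.inl hf)
  obtain ⟨i, j, -, rfl⟩ := hf
  refine initialForm_eq_self (D := 2) ?_ hf0
  exact ((MvPolynomial.isHomogeneous_X K _).mul (MvPolynomial.isHomogeneous_X K _)).sub
    ((MvPolynomial.isHomogeneous_X K _).mul (MvPolynomial.isHomogeneous_X K _))

theorem initialForm_extraMinor (he : 0 < e) (i k : Fin (n + 1)) :
    initialForm (MvPolynomial.X (Fin.last n) ^ q * MvPolynomial.X k -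
        MvPolynomial.X 0 ^ (q + e) * MvPolynomial.X i : MvPolynomial (Fin (n + 1)) K) =
      MvPolynomial.X (Fin.last n) ^ q * MvPolynomial.X k := by
  rw [sub_eq_add_neg]
  refine initialForm_add_eq (D := q + 1) (E := q + e + 1) ?_ ?_ ?_ (by omega)
  · exact (MvPolynomial.isHomogeneous_X_pow _ _).mul (MvPolynomial.isHomogeneous_X K _)
  · exact mul_ne_zero (pow_ne_zero _ (MvPolynomial.X_ne_zero _)) (MvPolynomial.X_ne_zero _)
  · exact ((MvPolynomial.isHomogeneous_X_pow _ _).mul (MvPolynomial.isHomogeneous_X K _)).neg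

/-- Modulo the initial forms, bidegrees with `s` at least `q * n + b` vanish; in the others the
coefficients of an element of the truncation sum to zero. -/
theorem scrollTruncation_le_span_initialForm (he : 0 < e) (hb : 1 ≤ b) (hbn : b ≤ n) :
    scrollTruncation K n (q * n + b) ≤
      Ideal.span (initialForm '' arithmeticGenerators K n q b e) := by
  classical
  intro f hf
  set φ := Ideal.Quotient.mk (Ideal.span (initialForm '' arithmeticGenerators K n q b e)) with hφ
  have hzero : ∀ f ∈ arithmeticGenerators K n q b e, φ (initialForm f) = 0 := fun f hf =>
    Ideal.Quotient.eq_zero_iff_mem.2 (Ideal.subset_span ⟨f, hf, rfl⟩)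
  have hy := satisfiesScroll_of_map_eq_zero φ fun f hf => by
    rw [← initialForm_scrollMinor hf]
    exact hzero f (Or.inl hf)
  have hX : ∀ i : Fin (n + 1), φ (MvPolynomial.X i) =
      φ (MvPolynomial.X (Fin.ofNat (n + 1) (i : ℕ))) := fun i => by rw [ofNat_natCast_eq]
  have hq : ∀ i, b + i ≤ n → φ (MvPolynomial.X (Fin.ofNat (n + 1) n)) ^ q *
      φ (MvPolynomial.X (Fin.ofNat (n + 1) (b + i))) = 0 := by
    intro i hi
    have := hzero _ (Or.inr ⟨⟨i, by omega⟩, ⟨b + i, by omega⟩, rfl, rfl⟩)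
    rw [initialForm_extraMinor he, map_mul, map_pow, hX (Fin.last n), hX ⟨b + i, _⟩] at this
    exact this
  rw [← Ideal.Quotient.eq_zero_iff_mem, mk_eq_sum]
  -- The cutoff discards pairs that are the bidegree of no monomial, where `scrollMonomial` has no
  -- meaning.
  let c : ℕ × ℕ → MvPolynomial (Fin (n + 1)) K ⧸
      Ideal.span (initialForm '' arithmeticGenerators K n q b e) := fun p =>
    if p.2 ≤ n * p.1 then
      scrollMonomial n (fun i => φ (MvPolynomial.X (Fin.ofNat (n + 1) i))) p.1 p.2
    else 0
  have hc : ∀ u, φ (MvPolynomial.monomial u 1) = c (u.degree, indexSum n u) := fun u => by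
    rw [map_monomial_eq_scrollMonomial φ hX hy]
    exact (if_pos (indexSum_le u)).symm
  simp only [← hφ, hc]
  refine sum_coeff_smul_eq_zero f (fun u => (u.degree, indexSum n u)) c fun p => ?_
  by_cases hs : p.2 ≤ n * p.1
  · by_cases hm : q * n + b ≤ p.2
    · left
      simp only [c, if_pos hs]
      exact hy.scrollMonomial_eq_zero hb hbn hq hs hm
    · right
      rw [← coeff_coeff_toScroll]
      exact mem_scrollTruncation_iff.1 hf _ _ (by omega)
  · exact Or.inl (if_neg hs)

theorem ArithmeticData.initialIdeal_le_scrollTruncation (h : ArithmeticData a d g m e q b) :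
    initialIdeal (semigroupIdeal K a) ≤ scrollTruncation K n m := by
  refine Ideal.span_le.2 ?_
  rintro _ ⟨f, hf, -, rfl⟩
  exact h.initialForm_mem_scrollTruncation hf

theorem ArithmeticData.span_initialForm_le (h : ArithmeticData a d g m e q b) :
    Ideal.span (initialForm '' arithmeticGenerators K n q b e) ≤
      initialIdeal (semigroupIdeal K a) := by
  refine Ideal.span_mono ?_
  rintro _ ⟨f, hf, rfl⟩
  exact ⟨f, h.arithmeticGenerators_subset hf,
    ne_zero_of_mem_arithmeticGenerators h.q_pos h.e_pos hf, rfl⟩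

theorem ArithmeticData.span_initialForm_eq (h : ArithmeticData a d g m e q b) :
    Ideal.span (initialForm '' arithmeticGenerators K n q b e) =
      initialIdeal (semigroupIdeal K a) :=
  le_antisymm h.span_initialForm_le (h.initialIdeal_le_scrollTruncation.trans
    (h.m_eq ▸ scrollTruncation_le_span_initialForm h.e_pos h.one_le_b h.b_le))

theorem ArithmeticData.initialIdeal_eq_scrollTruncation (h : ArithmeticData a d g m e q b) :
    initialIdeal (semigroupIdeal K a) = scrollTruncation K n m :=
  le_antisymm h.initialIdeal_le_scrollTruncation
    ((h.m_eq ▸ scrollTruncation_le_span_initialForm h.e_pos h.one_le_b h.b_le :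
      scrollTruncation K n m ≤ _).trans h.span_initialForm_le)

/-- Each generator differs from its initial form by a multiple of `x_0`. -/
theorem ArithmeticData.initialIdeal_sup_span_X_zero (h : ArithmeticData a d g m e q b) :
    initialIdeal (semigroupIdeal K a) ⊔ Ideal.span {MvPolynomial.X 0} =
      semigroupIdeal K a ⊔ Ideal.span {MvPolynomial.X 0} := by
  rw [← h.span_initialForm_eq, ← h.span_arithmeticGenerators]
  have hmem : ∀ f ∈ arithmeticGenerators K n q b e,
      f - initialForm f ∈ Ideal.span {(MvPolynomial.X 0 : MvPolynomial (Fin (n + 1)) K)} := by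
    rintro f (hf | ⟨i, k, -, rfl⟩)
    · rw [initialForm_scrollMinor hf, sub_self]
      exact zero_mem _
    · rw [initialForm_extraMinor h.e_pos, sub_sub_cancel_left, neg_mem_iff]
      refine Ideal.mul_mem_right _ _ (Ideal.pow_mem_of_mem _ (Ideal.mem_span_singleton_self _) _ ?_)
      have := h.q_pos
      omega
  apply le_antisymm <;> refine sup_le (Ideal.span_le.2 ?_) le_sup_right
  · rintro _ ⟨f, hf, rfl⟩
    rw [← sub_sub_self f (initialForm f)]
    exact sub_mem (Ideal.mem_sup_left (Ideal.subset_span hf)) (Ideal.mem_sup_right (hmem f hf))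
  · intro f hf
    rw [← sub_add_cancel f (initialForm f)]
    exact add_mem (Ideal.mem_sup_right (hmem f hf))
      (Ideal.mem_sup_left (Ideal.subset_span ⟨f, hf, rfl⟩))

theorem mem_semigroupIdeal_of_X_zero_mul_mem {f : MvPolynomial (Fin (n + 1)) K}
    (hf : MvPolynomial.X 0 * f ∈ semigroupIdeal K a) : f ∈ semigroupIdeal K a := by
  rw [semigroupIdeal, RingHom.mem_ker] at hf ⊢
  rw [map_mul] at hf
  refine (mul_eq_zero.1 hf).resolve_left ?_
  simp

theorem ArithmeticData.bettiNumber_initialIdeal (h : ArithmeticData a d g m e q b) (i : ℕ) :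
    bettiNumber i (initialIdeal (semigroupIdeal K a)) = bettiNumber i (semigroupIdeal K a) := by
  refine bettiNumber_eq_of_sup_span_eq (MvPolynomial.X_ne_zero 0)
    (Ideal.subset_span (Set.mem_range_self 0)) (fun f hf => ?_)
    (fun f hf => mem_semigroupIdeal_of_X_zero_mul_mem hf) h.initialIdeal_sup_span_X_zero i
  rw [h.initialIdeal_eq_scrollTruncation] at hf ⊢
  exact mem_scrollTruncation_of_X_zero_mul_mem hf

theorem apply_eq_of_isArithmeticWithDifference (ha : IsArithmeticWithDifference a d)
    (i : Fin (n + 1)) : a i = a 0 + i * d := by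
  induction i using Fin.induction with
  | zero => simp
  | succ i ih =>
    rw [ha i.castSucc i.succ (by simp), ih, Fin.val_succ, Fin.val_castSucc]
    ring

theorem exists_arithmeticData (hn : 1 ≤ n) (hd : 0 < d) (ha : IsArithmeticWithDifference a d)
    {H : AddSubmonoid ℕ} (hH : MinimallyGenerates a H) :
    ∃ q b, ArithmeticData a d (Nat.gcd (a 0) d) (a 0 / Nat.gcd (a 0) d)
      (d / Nat.gcd (a 0) d) q b := by
  have happ := apply_eq_of_isArithmeticWithDifference ha
  have hg : 0 < Nat.gcd (a 0) d := Nat.gcd_pos_of_pos_right _ hd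
  have h1 : a 0 = Nat.gcd (a 0) d * (a 0 / Nat.gcd (a 0) d) :=
    (Nat.mul_div_cancel' (Nat.gcd_dvd_left _ _)).symm
  have h2 : d = Nat.gcd (a 0) d * (d / Nat.gcd (a 0) d) :=
    (Nat.mul_div_cancel' (Nat.gcd_dvd_right _ _)).symm
  have he : 0 < d / Nat.gcd (a 0) d := Nat.div_pos (Nat.gcd_le_right _ hd) hg
  have hcop := Nat.coprime_div_gcd_div_gcd hg
  generalize Nat.gcd (a 0) d = g at *
  generalize a 0 / g = m at *
  generalize d / g = e at *
  have ha0 : a 0 ≠ 0 := fun h => hH.2 0 (by rw [h]; exact zero_mem _)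
  have hm0 : m ≠ 0 := by rintro rfl; exact ha0 (by simpa using h1)
  -- If `m ≤ n`, then `a m = a 0 + m * d = (e + 1) * a 0` is redundant, against minimality. This is
  -- what gives `q > 0`.
  have hm : n < m := by
    by_contra hle
    let j : Fin (n + 1) := ⟨m, by omega⟩
    apply hH.2 j
    have hj : a j = (e + 1) • a 0 := by
      rw [happ j, smul_eq_mul, h1, h2]
      ring
    rw [hj]
    have hmem : a 0 ∈ AddSubmonoid.closure (a '' {k | k ≠ j}) :=
      AddSubmonoid.subset_closure
        (Set.mem_image_of_mem a fun h0 : (0 : Fin (n + 1)) = j => hm0 (congrArg Fin.val h0).symm)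
    exact AddSubmonoid.nsmul_mem _ hmem _
  -- Dividing `m - 1` instead of `m` puts the remainder `b` in `1, …, n`.
  refine ⟨(m - 1) / n, (m - 1) % n + 1, happ, h1, h2, hg, he, hcop, ?_, ?_, by omega, ?_⟩
  · have := Nat.div_add_mod (m - 1) n
    rw [mul_comm] at this
    omega
  · exact Nat.div_pos (by omega) hn
  · exact Nat.mod_lt _ hn

end StandardBasis

end TangentCone

end

/-- The sequence has `r = n + 1 ≥ 2` terms `a 0 < a 1 < ⋯ < a n`. -/
theorem proposition2p4 (K : Type u) [Field K] (n : ℕ) (hn : 1 ≤ n)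
    (a : Fin (n + 1) → ℕ) (d : ℕ) (hd : 0 < d)
    (ha : TangentCone.IsArithmeticWithDifference a d)
    (H : AddSubmonoid ℕ) (hH : TangentCone.MinimallyGenerates a H) :
    (∃ q b : ℕ, 0 < q ∧ 1 ≤ b ∧ b ≤ n ∧ a 0 / Nat.gcd (a 0) d = q * n + b ∧
      TangentCone.IsMinimalGeneratingSet
        (TangentCone.arithmeticGenerators K n q b (d / Nat.gcd (a 0) d))
        (TangentCone.semigroupIdeal K a) ∧
      TangentCone.IsStandardBasis
        (TangentCone.arithmeticGenerators K n q b (d / Nat.gcd (a 0) d))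
        (TangentCone.semigroupIdeal K a)) ∧
    ∀ i : ℕ,
      TangentCone.bettiNumber i (TangentCone.initialIdeal (TangentCone.semigroupIdeal K a)) =
        TangentCone.bettiNumber i (TangentCone.semigroupIdeal K a) := by
  obtain ⟨q, b, h⟩ := TangentCone.exists_arithmeticData hn hd ha hH
  refine ⟨⟨q, b, h.q_pos, h.one_le_b, h.b_le, h.m_eq, ⟨h.span_arithmeticGenerators, ?_⟩,
    TangentCone.finite_arithmeticGenerators, ?_, h.span_initialForm_eq⟩,
    h.bettiNumber_initialIdeal⟩
  · intro T hT
    rw [← h.span_arithmeticGenerators]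
    exact TangentCone.span_ne_of_ssubset
      (fun f hf => TangentCone.exists_isSeparating h.q_pos h.e_pos hf) hT
  · exact fun f hf => ⟨h.arithmeticGenerators_subset hf,
      TangentCone.ne_zero_of_mem_arithmeticGenerators h.q_pos h.e_pos hf⟩
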